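/- Consider two parallel queues with Poisson arrivals of rate $\lambda>0$. An arriving customer joins the shorter queue; if the queues have equal lengths it joins queue 1 with probability $a_1\in[0,1]$ and queue 2 with probability $a_2=1-a_1$. Service times are exponential with rates $\mu_1,\mu_2>0$ in queues 1 and 2, each queue uses the processor-sharing discipline (so that each of $n$ customers present in queue $q$ completes its service at rate $\mu_q/n$), and $\lambda<\mu_1+\mu_2$. For $i,j\ge 0$ let $U_{i,j}$ (resp. $V_{i,j}$) be the remaining time to completion of service of a tagged customer in queue 1 (resp. queue 2) when there are $i$ and $j$ other customers in queues 1 and 2, and let $U^*_{i,j}(s)$, $V^*_{i,j}(s)$ be the Laplace–Stieltjes transforms of their distributions, for $s\in\mathbb C$ with $\operatorname{Re}s\ge 0$. For an array $c=(c_{i,j})_{i,j\ge0}$ and a relation $\sim$ put $f(x,y)=\sum_{i,j\ge 0}c_{i,j}x^iy^j$ and $f^\sim(x,y)=\sum_{i\sim j}c_{i,j}x^iy^j$. Let $E(x,y,s)$ and $F(x,y,s)$ be the series with coefficients $U^*_{i,j}(s)$ and $V^*_{i,j}(s)$, and let $\beta_E,\delta_E,\alpha_F,\gamma_F$ be the series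 with coefficients $U^*_{i,j+1}(s)$, $U^*_{i,j+2}(s)$, $V^*_{i+1,j}(s)$, $V^*_{i+2,j}(s)$ respectively. Then the series $E,E^<,E^=,\beta_E^\ge,\delta_E^=,F,F^>,F^=,\alpha_F^\le,\gamma_F^=$ converge absolutely and are holomorphic for $|x|<1$, $|y|<1$, and for all such $x,y$ $$\begin{aligned} &\big(s+\lambda+(1-x)\mu_1+(1-y)\mu_2\big)\Big(E(x,y,s)+x\frac{\partial E}{\partial x}(x,y,s)\Big)-\mu_2\Big(E(x,0,s)+x\frac{\partial E}{\partial x}(x,0,s)\Big)-\lambda\frac{\partial E^{<}}{\partial x}(x,y,s)\\ &\quad-\lambda\Big(\beta_E^{\ge}(x,y,s)+x\frac{\partial\beta_E^{\ge}}{\partial x}(x,y,s)\Big)-\lambda a_1\frac{\partial E^{=}}{\partial x}(x,y,s)-\lambda a_2y\Big(\delta_E^{=}(x,y,s)+x\frac{\partial\delta_E^{=}}{\partial x}(x,y,s)\Big)=\frac{\mu_1}{(1-x)(1-y)} \end{aligned}$$ and $$\begin{aligned} &\big(s+\lambda+(1-x)\mu_1+(1-y)\mu_2\big)\Big(F(x,y,s)+y\frac{\partial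 F}{\partial y}(x,y,s)\Big)-\mu_1\Big(F(0,y,s)+y\frac{\partial F}{\partial y}(0,y,s)\Big)-\lambda\frac{\partial F^{>}}{\partial y}(x,y,s)\\ &\quad-\lambda\Big(\alpha_F^{\le}(x,y,s)+y\frac{\partial\alpha_F^{\le}}{\partial y}(x,y,s)\Big)-\lambda a_2\frac{\partial F^{=}}{\partial y}(x,y,s)-\lambda a_1x\Big(\gamma_F^{=}(x,y,s)+y\frac{\partial\gamma_F^{=}}{\partial y}(x,y,s)\Big)=\frac{\mu_2}{(1-x)(1-y)} . \end{aligned}$$ -/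

import Mathlib

open MeasureTheory ProbabilityTheory
open scoped ENNReal

/-! ### Continuous-time Markov chains from jump rates -/

namespace CTMC

/-- The total rate of leaving `z`, when `R z A` is the rate of jumping from `z` into `A`. -/
noncomputable def exitRate {S : Type*} [MeasurableSpace S] (R : S → Measure S) (z : S) : ℝ :=
  (R z Set.univ).toReal

open Classical in
/-- One step of the chain from the state `z`: the law of the pair (next state, time spent in `z`).
The time spent in `z` is exponential with the total rate of `z`, and independently of it the next
state is chosen with probability proportional to the rates. A state of total rate zero is never
left: the chain spends an infinite time there. -/
noncomputable def stepLaw {S : Type*} [MeasurableSpace S] (R : S → Measure S) (z : S) :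
    Measure (S × ℝ≥0∞) :=
  if 0 < exitRate R z then
    ((R z Set.univ)⁻¹ • R z).prod ((expMeasure (exitRate R z)).map ENNReal.ofReal)
  else Measure.dirac (z, ⊤)

instance {S : Type*} [MeasurableSpace S] (R : S → Measure S) (z : S) :
    IsProbabilityMeasure (stepLaw R z) := by
  unfold stepLaw
  split_ifs with h
  · have h0 := (ENNReal.toReal_pos_iff.mp h)
    have h1 : IsProbabilityMeasure ((R z Set.univ)⁻¹ • R z) :=
      ⟨by simpa using ENNReal.inv_mul_cancel h0.1.ne' h0.2.ne⟩
    have h2 := isProbabilityMeasure_expMeasure h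
    have h3 : IsProbabilityMeasure ((expMeasure (exitRate R z)).map ENNReal.ofReal) :=
      Measure.isProbabilityMeasure_map ENNReal.measurable_ofReal.aemeasurable
    infer_instance
  · infer_instance

/-- The transition kernel of the sequence of pairs (state, time spent in the preceding state). -/
noncomputable def stepKernel {S : Type*} [MeasurableSpace S] [Countable S]
    [MeasurableSingletonClass S] (R : S → Measure S) : Kernel (S × ℝ≥0∞) (S × ℝ≥0∞) :=
  (Kernel.ofFunOfCountable (stepLaw R)).comap Prod.fst measurable_fst

instance {S : Type*} [MeasurableSpace S] [Countable S] [MeasurableSingletonClass S]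
    (R : S → Measure S) : IsMarkovKernel (stepKernel R) :=
  ⟨fun p => inferInstanceAs (IsProbabilityMeasure (stepLaw R p.1))⟩

/-- The law of the continuous-time Markov chain with rates `R` started in `z`, as a law on the
sequences `ω`, where `(ω n).1` is the state after `n` jumps and `(ω (n + 1)).2` is the time spent in
that state (the number `(ω 0).2` has no meaning and is put equal to `0`). -/
noncomputable def pathLaw {S : Type*} [MeasurableSpace S] [Countable S]
    [MeasurableSingletonClass S] (R : S → Measure S) (z : S) : Measure (ℕ → S × ℝ≥0∞) :=
  Kernel.traj (X := fun _ => S × ℝ≥0∞)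
    (fun n => (stepKernel R).comap
      (fun h : (i : Finset.Iic n) → S × ℝ≥0∞ => h ⟨n, Finset.mem_Iic.mpr le_rfl⟩)
      (measurable_pi_apply _))
    0 (fun _ => (z, 0))

/-- The time of the `n`-th jump. -/
noncomputable def jumpTime {S : Type*} (n : ℕ) (ω : ℕ → S × ℝ≥0∞) : ℝ≥0∞ :=
  ∑ k ∈ Finset.range n, (ω (k + 1)).2

/-- The first time at which the chain is in the state `z`, infinite if it never gets there. -/
noncomputable def hittingTime {S : Type*} (z : S) (ω : ℕ → S × ℝ≥0∞) : ℝ≥0∞ :=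
  ⨅ n : ℕ, ⨅ _ : (ω n).1 = z, jumpTime n ω

theorem measurable_hittingTime {S : Type*} [MeasurableSpace S] [MeasurableSingletonClass S]
    (z : S) : Measurable (hittingTime z : (ℕ → S × ℝ≥0∞) → ℝ≥0∞) := by
  classical
  refine Measurable.iInf fun n => ?_
  have hJ : Measurable (jumpTime n : (ℕ → S × ℝ≥0∞) → ℝ≥0∞) :=
    Finset.measurable_sum _ fun k _ => (measurable_pi_apply (k + 1)).snd
  have hA : MeasurableSet {ω : ℕ → S × ℝ≥0∞ | (ω n).1 = z} :=
    (measurable_pi_apply n).fst (measurableSet_singleton z)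
  have : (fun ω : ℕ → S × ℝ≥0∞ => ⨅ _ : (ω n).1 = z, jumpTime n ω)
      = fun ω => if (ω n).1 = z then jumpTime n ω else ⊤ := by
    funext ω
    exact iInf_eq_if _
  rw [this]
  exact Measurable.ite hA hJ measurable_const

/-- The law of the first time at which the chain started in `z` is in the state `z'`. -/
noncomputable def hittingLaw {S : Type*} [MeasurableSpace S] [Countable S]
    [MeasurableSingletonClass S] (R : S → Measure S) (z z' : S) : Measure ℝ≥0∞ :=
  (pathLaw R z).map (hittingTime z')

end CTMC

/-! ### Two parallel processor-sharing queues with Join-the-Shortest-Queue routing -/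

namespace JSQ

/-- The parameters: the arrival rate `lam`, the service rates `mu1` and `mu2` of the two queues, and
the probability `a1` that a customer who finds queues of equal length joins queue 1. -/
structure Params where
  lam : ℝ
  mu1 : ℝ
  mu2 : ℝ
  a1 : ℝ

/-- The probability that a customer who finds queues of equal length joins queue 2. -/
def Params.a2 (Q : Params) : ℝ := 1 - Q.a1

/-- The state of the system seen from a tagged customer: `inQueue1 i j` (resp. `inQueue2 i j`) when
the tagged customer is in queue 1 (resp. queue 2) and there are `i` other customers in queue 1 and
`j` other customers in queue 2; `departed` when the service of the tagged customer is completed. -/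
inductive State : Type
  | inQueue1 (i j : ℕ)
  | inQueue2 (i j : ℕ)
  | departed

instance : MeasurableSpace State := ⊤

instance : DiscreteMeasurableSpace State := ⟨fun _ => trivial⟩

instance : Countable State := by
  let f : State → Option (Bool × ℕ × ℕ) := fun z => match z with
    | .inQueue1 i j => some (true, i, j)
    | .inQueue2 i j => some (false, i, j)
    | .departed => none
  have hf : Function.Injective f := by
    intro a b h
    cases a <;> cases b <;> simp_all [f]
  exact hf.countable

/-- The probability that an arriving customer joins queue 1 when the lengths of the queues are
`n1` and `n2`. -/
noncomputable def toQueue1 (Q : Params) (n1 n2 : ℕ) : ℝ :=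
  if n1 < n2 then 1 else if n1 = n2 then Q.a1 else 0

/-- The probability that an arriving customer joins queue 2 when the lengths of the queues are
`n1` and `n2`. -/
noncomputable def toQueue2 (Q : Params) (n1 n2 : ℕ) : ℝ :=
  if n2 < n1 then 1 else if n1 = n2 then Q.a2 else 0

/-- The jump rates. Customers arrive at rate `lam` and join the shorter queue; in a queue with `n`
customers and service rate `mu`, the service of each single customer is completed at rate `mu / n`,
since the customers share the server equally and the service times are exponential. With the tagged
customer in queue 1 the lengths of the queues are `i + 1` and `j`; with the tagged customer in
queue 2 they are `i` and `j + 1`. (When there is no other customer in a queue, the rate of the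
departure of another customer from it is zero, so that the truncated subtraction does not matter.) -/
noncomputable def rates (Q : Params) : State → Measure State
  | .inQueue1 i j =>
      ENNReal.ofReal (Q.lam * toQueue1 Q (i + 1) j) • Measure.dirac (.inQueue1 (i + 1) j)
      + ENNReal.ofReal (Q.lam * toQueue2 Q (i + 1) j) • Measure.dirac (.inQueue1 i (j + 1))
      + ENNReal.ofReal (i * (Q.mu1 / (i + 1 : ℕ))) • Measure.dirac (.inQueue1 (i - 1) j)
      + ENNReal.ofReal (j * (Q.mu2 / j)) • Measure.dirac (.inQueue1 i (j - 1))
      + ENNReal.ofReal (Q.mu1 / (i + 1 : ℕ)) • Measure.dirac .departed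
  | .inQueue2 i j =>
      ENNReal.ofReal (Q.lam * toQueue1 Q i (j + 1)) • Measure.dirac (.inQueue2 (i + 1) j)
      + ENNReal.ofReal (Q.lam * toQueue2 Q i (j + 1)) • Measure.dirac (.inQueue2 i (j + 1))
      + ENNReal.ofReal (i * (Q.mu1 / i)) • Measure.dirac (.inQueue2 (i - 1) j)
      + ENNReal.ofReal (j * (Q.mu2 / (j + 1 : ℕ))) • Measure.dirac (.inQueue2 i (j - 1))
      + ENNReal.ofReal (Q.mu2 / (j + 1 : ℕ)) • Measure.dirac .departed
  | .departed => 0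

/-- The law of the remaining time to completion of service of a tagged customer in queue 1 when
there are `i` and `j` other customers in queues 1 and 2. -/
noncomputable def lawU (Q : Params) (i j : ℕ) : Measure ℝ≥0∞ :=
  CTMC.hittingLaw (rates Q) (.inQueue1 i j) .departed

/-- The law of the remaining time to completion of service of a tagged customer in queue 2 when
there are `i` and `j` other customers in queues 1 and 2. -/
noncomputable def lawV (Q : Params) (i j : ℕ) : Measure ℝ≥0∞ :=
  CTMC.hittingLaw (rates Q) (.inQueue2 i j) .departed

/-- The Laplace–Stieltjes transform of a law on `[0, ∞]` (a possible atom at `∞` does not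
contribute). -/
noncomputable def lst (ν : Measure ℝ≥0∞) (s : ℂ) : ℂ :=
  ∫ t in {t : ℝ≥0∞ | t ≠ ⊤}, Complex.exp (-(s * (t.toReal : ℂ))) ∂ν

/-- `U*_{i,j}(s)`. -/
noncomputable def Ustar (Q : Params) (s : ℂ) (i j : ℕ) : ℂ := lst (lawU Q i j) s

/-- `V*_{i,j}(s)`. -/
noncomputable def Vstar (Q : Params) (s : ℂ) (i j : ℕ) : ℂ := lst (lawV Q i j) s

/-! ### Generating functions -/

/-- The generating function `∑_{i,j} c i j x^i y^j`. -/
noncomputable def gf (c : ℕ → ℕ → ℂ) (x y : ℂ) : ℂ :=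
  ∑' p : ℕ × ℕ, c p.1 p.2 * x ^ p.1 * y ^ p.2

/-- The double power series of `c` converges absolutely in the open unit bidisk, and its sum is
holomorphic there. -/
def HolomorphicSeries (c : ℕ → ℕ → ℂ) : Prop :=
  (∀ x y : ℂ, ‖x‖ < 1 → ‖y‖ < 1 →
    Summable fun p : ℕ × ℕ => ‖c p.1 p.2 * x ^ p.1 * y ^ p.2‖) ∧
  DifferentiableOn ℂ (fun p : ℂ × ℂ => gf c p.1 p.2)
    {p : ℂ × ℂ | ‖p.1‖ < 1 ∧ ‖p.2‖ < 1}

open Classical in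
/-- The coefficients `c i j` with `i ∼ j` for a relation `∼`, the others being replaced by `0`. -/
noncomputable def part (r : ℕ → ℕ → Prop) (c : ℕ → ℕ → ℂ) : ℕ → ℕ → ℂ :=
  fun i j => if r i j then c i j else 0

/-- Coefficients of `α`. -/
def alpha (c : ℕ → ℕ → ℂ) : ℕ → ℕ → ℂ := fun i j => c (i + 1) j

/-- Coefficients of `β`. -/
def beta (c : ℕ → ℕ → ℂ) : ℕ → ℕ → ℂ := fun i j => c i (j + 1)

/-- Coefficients of `γ`. -/
def gamma (c : ℕ → ℕ → ℂ) : ℕ → ℕ → ℂ := fun i j => c (i + 2) j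

/-- Coefficients of `δ`. -/
def delta (c : ℕ → ℕ → ℂ) : ℕ → ℕ → ℂ := fun i j => c i (j + 2)

/-- `E(x,y,s)`. -/
noncomputable def E (Q : Params) (x y s : ℂ) : ℂ := gf (Ustar Q s) x y

/-- `E^<(x,y,s)`. -/
noncomputable def Elt (Q : Params) (x y s : ℂ) : ℂ := gf (part (· < ·) (Ustar Q s)) x y

/-- `E^=(x,y,s)`. -/
noncomputable def Eeq (Q : Params) (x y s : ℂ) : ℂ := gf (part (· = ·) (Ustar Q s)) x y

/-- `β_E^≥(x,y,s)`. -/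
noncomputable def betaEge (Q : Params) (x y s : ℂ) : ℂ :=
  gf (part (· ≥ ·) (beta (Ustar Q s))) x y

/-- `δ_E^=(x,y,s)`. -/
noncomputable def deltaEeq (Q : Params) (x y s : ℂ) : ℂ :=
  gf (part (· = ·) (delta (Ustar Q s))) x y

/-- `F(x,y,s)`. -/
noncomputable def F (Q : Params) (x y s : ℂ) : ℂ := gf (Vstar Q s) x y

/-- `F^>(x,y,s)`. -/
noncomputable def Fgt (Q : Params) (x y s : ℂ) : ℂ := gf (part (· > ·) (Vstar Q s)) x y

/-- `F^=(x,y,s)`. -/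
noncomputable def Feq (Q : Params) (x y s : ℂ) : ℂ := gf (part (· = ·) (Vstar Q s)) x y

/-- `α_F^≤(x,y,s)`. -/
noncomputable def alphaFle (Q : Params) (x y s : ℂ) : ℂ :=
  gf (part (· ≤ ·) (alpha (Vstar Q s))) x y

/-- `γ_F^=(x,y,s)`. -/
noncomputable def gammaFeq (Q : Params) (x y s : ℂ) : ℂ :=
  gf (part (· = ·) (gamma (Vstar Q s))) x y

end JSQ

/-! Conditioning on the first jump gives, for each state `z` other than the target, (exit rate of
`z` + s) times the transform at `z` = the integral of the transforms over the jump rates of `z`.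
This is `CTMC.exitRate_add_mul_lst_hittingLaw`; it rests on the Markov property at time one,
`chainLaw_map_shift`, and on the independence of holding time and next state.

For a tagged customer in queue 1, multiplying by i + 1 clears the processor-sharing denominators:
the departure of the tagged customer contributes the constant μ₁, and the other departures from
queue 1 contribute μ₁ i U*_{i-1,j}. The resulting recursion is `JSQ.FirstStepEquations`. Multiply it
by x^i y^j and sum. The weight i + 1 on the coefficients is the operator 1 + x ∂/∂x, the
coefficients (i+1) c_{i+1,j} give ∂/∂x, index shifts become factors x and y, the missing service at
j = 0 produces the E(x,0,s) terms, and the constant μ₁ becomes the geometric series. Since Re s ≥ 0,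
all transforms have modulus at most 1, which justifies the summation and termwise differentiation in
the bidisk. The second equation is the first with the queues exchanged. -/

/-! ### Markov property at time one for homogeneous chains -/

namespace HomogeneousChain

open Finset Preorder

variable {X : Type*} [MeasurableSpace X]

/-- The transition kernels of a homogeneous Markov chain, as functions of the whole past. -/
noncomputable def pastKernel (P : Kernel X X) (n : ℕ) : Kernel ((i : Iic n) → X) X :=
  P.comap (fun h => h ⟨n, mem_Iic.mpr le_rfl⟩) (measurable_pi_apply _)

instance (P : Kernel X X) [IsMarkovKernel P] (n : ℕ) : IsMarkovKernel (pastKernel P n) := by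
  unfold pastKernel; infer_instance

/-- The law of the homogeneous Markov chain with transition kernel `P`, as a kernel of its initial
value. -/
noncomputable def chainLaw (P : Kernel X X) [IsMarkovKernel P] : Kernel X (ℕ → X) :=
  (Kernel.traj (X := fun _ => X) (pastKernel P) 0).comap (fun x _ => x) (by fun_prop)

instance (P : Kernel X X) [IsMarkovKernel P] : IsMarkovKernel (chainLaw P) := by
  unfold chainLaw; infer_instance

/-- The sequence without its initial value. -/
def shift (ω : ℕ → X) : ℕ → X := fun n => ω (n + 1)

/-- The finite sequence without its initial value. -/
def shiftIic (n : ℕ) (h : (i : Iic (n + 1)) → X) : (i : Iic n) → X :=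
  fun i => h ⟨i + 1, mem_Iic.mpr (Nat.succ_le_succ (mem_Iic.mp i.2))⟩

/-- The extension of a finite sequence by one more value. -/
def extendIic (n : ℕ) (h : (i : Iic n) → X) (x : X) : (i : Iic (n + 1)) → X :=
  fun i => if hi : (i : ℕ) ≤ n then h ⟨i, mem_Iic.mpr hi⟩ else x

@[fun_prop]
theorem measurable_shift : Measurable (shift : (ℕ → X) → ℕ → X) :=
  measurable_pi_lambda _ fun n => measurable_pi_apply (n + 1)

@[fun_prop]
theorem measurable_shiftIic (n : ℕ) :
    Measurable (shiftIic n : ((i : Iic (n + 1)) → X) → (i : Iic n) → X) :=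
  measurable_pi_lambda _ fun _ => measurable_pi_apply _

@[fun_prop]
theorem measurable_extendIic (n : ℕ) (h : (i : Iic n) → X) : Measurable (extendIic n h) := by
  refine measurable_pi_lambda _ fun i => ?_
  unfold extendIic
  split_ifs
  · exact measurable_const
  · exact measurable_id

theorem partialTraj_succ_self_apply (P : Kernel X X) [IsMarkovKernel P] (n : ℕ)
    (h : (i : Iic n) → X) :
    Kernel.partialTraj (X := fun _ => X) (pastKernel P) n (n + 1) h
      = (P (h ⟨n, mem_Iic.mpr le_rfl⟩)).map (extendIic n h) := by
  have hI : Measurable (IicProdIoc (X := fun _ : ℕ => X) n (n + 1)) := measurable_IicProdIoc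
  have hS : Measurable (MeasurableEquiv.piSingleton (X := fun _ : ℕ => X) n) :=
    MeasurableEquiv.measurable _
  rw [Kernel.partialTraj_succ_self, Kernel.map_apply _ hI, Kernel.prod_apply,
    Kernel.map_apply _ hS, Kernel.id_apply, Measure.dirac_prod,
    Measure.map_map hI measurable_prodMk_left, Measure.map_map (hI.comp measurable_prodMk_left) hS]
  have h1 : (IicProdIoc (X := fun _ : ℕ => X) n (n + 1) ∘ Prod.mk h)
      ∘ MeasurableEquiv.piSingleton (X := fun _ : ℕ => X) n = extendIic n h := by
    funext x i
    simp [IicProdIoc, extendIic, MeasurableEquiv.piSingleton]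
  rw [h1]
  rfl

/-- Homogeneity enters here: a transition sees only the last coordinate, through the same `P` at
every time, and dropping the initial value leaves that coordinate in place. -/
theorem partialTraj_succ_self_map_shiftIic (P : Kernel X X) [IsMarkovKernel P] (n : ℕ) :
    (Kernel.partialTraj (X := fun _ => X) (pastKernel P) (n + 1) (n + 2)).map (shiftIic (n + 1))
      = (Kernel.partialTraj (X := fun _ => X) (pastKernel P) n (n + 1)).comap (shiftIic n)
          (measurable_shiftIic n) := by
  ext1 h
  rw [Kernel.map_apply _ (by fun_prop), Kernel.comap_apply, partialTraj_succ_self_apply,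
    partialTraj_succ_self_apply, Measure.map_map (by fun_prop) (by fun_prop)]
  congr 1
  funext x i
  simp [shiftIic, extendIic]

theorem partialTraj_map_shiftIic (P : Kernel X X) [IsMarkovKernel P] {a n : ℕ} (han : a ≤ n) :
    (Kernel.partialTraj (X := fun _ => X) (pastKernel P) (a + 1) (n + 1)).map (shiftIic n)
      = (Kernel.partialTraj (X := fun _ => X) (pastKernel P) a n).comap (shiftIic a)
          (measurable_shiftIic a) := by
  induction n, han using Nat.le_induction with
  | base =>
    rw [Kernel.partialTraj_self, Kernel.partialTraj_self]
    ext1 h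
    rw [Kernel.map_apply _ (by fun_prop), Kernel.comap_apply, Kernel.id_apply, Kernel.id_apply,
      Measure.map_dirac' (by fun_prop)]
  | succ n han ih =>
    rw [Kernel.partialTraj_succ_eq_comp (by omega : a + 1 ≤ n + 1), Kernel.map_comp,
      partialTraj_succ_self_map_shiftIic, Kernel.partialTraj_succ_eq_comp han,
      ← Kernel.comp_map _ _ (measurable_shiftIic n), ih]
    rfl

/-- Both sides are projective limits of one family of finite-dimensional laws, by
`partialTraj_map_shiftIic`, and such a limit of finite measures is unique. -/
theorem traj_map_shift (P : Kernel X X) [IsMarkovKernel P] (a : ℕ) :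
    (Kernel.traj (X := fun _ => X) (pastKernel P) (a + 1)).map shift
      = (Kernel.traj (X := fun _ => X) (pastKernel P) a).comap (shiftIic a)
          (measurable_shiftIic a) := by
  ext1 h
  have hfam := Kernel.isProjectiveMeasureFamily_partialTraj (X := fun _ => X) (pastKernel P)
    (shiftIic a h)
  have hlim := Kernel.isProjectiveLimit_trajFun (X := fun _ => X) (pastKernel P) a (shiftIic a h)
  rw [Kernel.map_apply _ measurable_shift]
  have hfin (n : ℕ) : IsFiniteMeasure
      (Kernel.partialTraj (X := fun _ => X) (pastKernel P) a n (shiftIic a h)) := inferInstance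
  have hfin' (I : Finset ℕ) : IsFiniteMeasure (inducedFamily (X := fun _ => X)
      (fun n => Kernel.partialTraj (X := fun _ => X) (pastKernel P) a n (shiftIic a h)) I) := by
    rw [inducedFamily]
    infer_instance
  refine IsProjectiveLimit.unique ((isProjectiveLimit_nat_iff' hfam _ a).mpr fun n hn => ?_) hlim
  have hr (m : ℕ) : Measurable (frestrictLe (π := fun _ : ℕ => X) m) := measurable_frestrictLe m
  have h1 : frestrictLe (π := fun _ : ℕ => X) n ∘ shift
      = shiftIic n ∘ frestrictLe (π := fun _ : ℕ => X) (n + 1) := rfl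
  rw [inducedFamily_Iic, Measure.map_map (hr n) measurable_shift, h1,
    ← Measure.map_map (measurable_shiftIic n) (hr (n + 1)), Kernel.traj_map_frestrictLe_apply,
    ← Kernel.map_apply _ (measurable_shiftIic n), partialTraj_map_shiftIic P hn,
    Kernel.comap_apply]

/-- The Markov property at time one. The trajectory kernel is split at time 1; shifting the part
after it restarts the chain from a value drawn from `P`. -/
theorem chainLaw_map_shift (P : Kernel X X) [IsMarkovKernel P] :
    (chainLaw P).map shift = chainLaw P ∘ₖ P := by
  have hc : Measurable fun (x : X) (_ : Iic 0) => x := by fun_prop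
  have h1 : Kernel.traj (X := fun _ => X) (pastKernel P) 0
      = Kernel.traj (X := fun _ => X) (pastKernel P) 1
        ∘ₖ Kernel.partialTraj (X := fun _ => X) (pastKernel P) 0 1 :=
    (Kernel.traj_comp_partialTraj zero_le_one).symm
  have h2 : ((Kernel.partialTraj (X := fun _ => X) (pastKernel P) 0 1).map (shiftIic 0)).comap
      (fun x _ => x) hc = P.map fun x _ => x := by
    ext1 x
    rw [Kernel.comap_apply, Kernel.map_apply _ (by fun_prop), Kernel.map_apply _ (by fun_prop),
      partialTraj_succ_self_apply, Measure.map_map (by fun_prop) (by fun_prop)]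
    congr 1
  have h3 : (Kernel.traj (X := fun _ => X) (pastKernel P) 0).map shift
      = Kernel.traj (X := fun _ => X) (pastKernel P) 0
        ∘ₖ (Kernel.partialTraj (X := fun _ => X) (pastKernel P) 0 1).map (shiftIic 0) := by
    rw [Kernel.comp_map _ _ (measurable_shiftIic 0), ← traj_map_shift, ← Kernel.map_comp, ← h1]
  unfold chainLaw
  rw [← Kernel.comp_map _ _ hc, ← h2, ← Kernel.comap_map_comm _ hc measurable_shift, h3]
  rfl

theorem chainLaw_map_zero (P : Kernel X X) [IsMarkovKernel P] (x : X) :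
    (chainLaw P x).map (fun ω => ω 0) = Measure.dirac x := by
  have h1 : (fun ω : ℕ → X => ω 0)
      = (fun h : (i : Iic 0) → X => h ⟨0, mem_Iic.mpr le_rfl⟩) ∘ frestrictLe 0 := rfl
  rw [h1, ← Measure.map_map (by fun_prop) (by fun_prop), chainLaw, Kernel.comap_apply,
    Kernel.traj_map_frestrictLe_apply, Kernel.partialTraj_self, Kernel.id_apply,
    Measure.map_dirac' (by fun_prop)]

theorem ae_chainLaw_zero (P : Kernel X X) [IsMarkovKernel P] {p : X → Prop}
    (hp : MeasurableSet {y | p y}) {x : X} (hx : p x) : ∀ᵐ ω ∂chainLaw P x, p (ω 0) := by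
  have h := chainLaw_map_zero P x
  have h2 : ∀ᵐ y ∂((chainLaw P x).map fun ω => ω 0), p y := by
    rw [h, ae_dirac_iff hp]
    exact hx
  exact (ae_map_iff (measurable_pi_apply 0).aemeasurable hp).mp h2

end HomogeneousChain

/-! ### Laplace–Stieltjes transforms on `[0, ∞]` -/

/-- The function `t ↦ exp (-s t)` on `[0, ∞]`, with the value `0` at infinity. -/
noncomputable def expNeg (s : ℂ) (t : ℝ≥0∞) : ℂ :=
  {t : ℝ≥0∞ | t ≠ ⊤}.indicator (fun t => Complex.exp (-(s * (t.toReal : ℂ)))) t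

theorem expNeg_of_ne_top (s : ℂ) {t : ℝ≥0∞} (ht : t ≠ ⊤) :
    expNeg s t = Complex.exp (-(s * (t.toReal : ℂ))) :=
  Set.indicator_of_mem (s := {t : ℝ≥0∞ | t ≠ ⊤}) ht _

theorem expNeg_top (s : ℂ) : expNeg s ⊤ = 0 :=
  Set.indicator_of_notMem (s := {t : ℝ≥0∞ | t ≠ ⊤}) (fun h => h rfl) _

theorem expNeg_zero (s : ℂ) : expNeg s 0 = 1 := by
  rw [expNeg_of_ne_top s ENNReal.zero_ne_top]; simp

/-- The value 0 at infinity is absorbing for products, as infinity is for sums. Hence first-step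
analysis needs no proof that the hitting time is almost surely finite. -/
theorem expNeg_add (s : ℂ) (t u : ℝ≥0∞) : expNeg s (t + u) = expNeg s t * expNeg s u := by
  rcases eq_or_ne t ⊤ with rfl | ht
  · simp [expNeg_top]
  rcases eq_or_ne u ⊤ with rfl | hu
  · simp [expNeg_top]
  rw [expNeg_of_ne_top s ht, expNeg_of_ne_top s hu,
    expNeg_of_ne_top s (ENNReal.add_ne_top.mpr ⟨ht, hu⟩), ENNReal.toReal_add ht hu,
    ← Complex.exp_add]
  congr 1
  push_cast
  ring

theorem measurableSet_ne_top : MeasurableSet {t : ℝ≥0∞ | t ≠ ⊤} :=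
  (measurableSet_singleton (⊤ : ℝ≥0∞)).compl

@[fun_prop]
theorem measurable_expNeg (s : ℂ) : Measurable (expNeg s) := by
  refine Measurable.indicator ?_ measurableSet_ne_top
  exact Complex.measurable_exp.comp
    ((Complex.measurable_ofReal.comp ENNReal.measurable_toReal).const_mul s).neg

theorem norm_expNeg_le {s : ℂ} (hs : 0 ≤ s.re) (t : ℝ≥0∞) : ‖expNeg s t‖ ≤ 1 := by
  rcases eq_or_ne t ⊤ with rfl | ht
  · simp [expNeg_top]
  rw [expNeg_of_ne_top s ht, Complex.norm_exp, Real.exp_le_one_iff]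
  simpa using mul_nonneg hs ENNReal.toReal_nonneg

theorem lst_eq_integral (ν : Measure ℝ≥0∞) (s : ℂ) : JSQ.lst ν s = ∫ t, expNeg s t ∂ν :=
  (integral_indicator measurableSet_ne_top).symm

theorem norm_lst_le_one (ν : Measure ℝ≥0∞) [IsProbabilityMeasure ν] {s : ℂ} (hs : 0 ≤ s.re) :
    ‖JSQ.lst ν s‖ ≤ 1 := by
  rw [lst_eq_integral]
  simpa using norm_integral_le_of_norm_le_const (μ := ν) (ae_of_all _ (norm_expNeg_le hs))

theorem lst_map {Ω : Type*} [MeasurableSpace Ω] (μ : Measure Ω) {f : Ω → ℝ≥0∞} (hf : Measurable f)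
    (s : ℂ) : JSQ.lst (μ.map f) s = ∫ ω, expNeg s (f ω) ∂μ := by
  rw [lst_eq_integral, integral_map hf.aemeasurable (by fun_prop)]

theorem integral_expNeg_expMeasure {r : ℝ} (hr : 0 < r) {s : ℂ} (hs : 0 ≤ s.re) :
    ∫ t, expNeg s t ∂((expMeasure r).map ENNReal.ofReal) = r / (r + s) := by
  rw [integral_map ENNReal.measurable_ofReal.aemeasurable (by fun_prop)]
  have h1 : expMeasure r = volume.withDensity (exponentialPDF r) := rfl
  have hpdf : Measurable (exponentialPDF r) := (measurable_exponentialPDFReal r).ennreal_ofReal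
  rw [h1, integral_withDensity_eq_integral_toReal_smul hpdf
    (ae_of_all _ fun x => ENNReal.ofReal_lt_top)]
  have h2 : (fun x : ℝ => (exponentialPDF r x).toReal • expNeg s (ENNReal.ofReal x))
      = (Set.Ici 0).indicator fun x : ℝ => (r : ℂ) * Complex.exp (-(r + s) * x) := by
    funext x
    by_cases hx : 0 ≤ x
    · rw [Set.indicator_of_mem (Set.mem_Ici.mpr hx), exponentialPDF_of_nonneg hx,
        ENNReal.toReal_ofReal (by positivity), expNeg_of_ne_top s ENNReal.ofReal_ne_top,
        ENNReal.toReal_ofReal hx, Complex.real_smul, Complex.ofReal_mul, mul_assoc,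
        Complex.ofReal_exp, ← Complex.exp_add]
      congr 2
      push_cast
      ring
    · rw [Set.indicator_of_notMem (by simpa using hx), exponentialPDF_of_neg (not_le.mp hx)]
      simp
  have hre : (-((r : ℂ) + s)).re < 0 := by
    simp
    linarith
  have hne : (r : ℂ) + s ≠ 0 := by
    intro h
    simp [h] at hre
  rw [h2, integral_indicator measurableSet_Ici, integral_Ici_eq_integral_Ioi,
    integral_const_mul, integral_exp_mul_complex_Ioi hre 0]
  field_simp
  simp

/-! ### First-step analysis of hitting times -/

namespace CTMC

open HomogeneousChain

variable {S : Type*}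

theorem hittingTime_of_eq {z : S} {ω : ℕ → S × ℝ≥0∞} (h : (ω 0).1 = z) : hittingTime z ω = 0 := by
  refine le_antisymm ?_ zero_le
  refine (iInf_le_of_le 0 (iInf_le_of_le h ?_))
  simp [jumpTime]

theorem jumpTime_succ (n : ℕ) (ω : ℕ → S × ℝ≥0∞) :
    jumpTime (n + 1) ω = (shift ω 0).2 + jumpTime n (shift ω) := by
  rw [jumpTime, Finset.sum_range_succ', add_comm]
  rfl

/-- Index 0 does not compete in the infimum, and every later jump time begins with the first holding
time, which therefore comes out of the infimum. -/
theorem hittingTime_of_ne {z : S} {ω : ℕ → S × ℝ≥0∞} (h : (ω 0).1 ≠ z) :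
    hittingTime z ω = (shift ω 0).2 + hittingTime z (shift ω) := by
  refine le_antisymm ?_ ?_
  · unfold hittingTime
    rw [ENNReal.add_iInf]
    refine le_iInf fun n => ?_
    by_cases hn : (shift ω n).1 = z
    · rw [iInf_pos hn, ← jumpTime_succ]
      exact iInf_le_of_le (n + 1) (iInf_le _ hn)
    · rw [iInf_neg hn]
      simp
  · refine le_iInf fun n => le_iInf fun hn => ?_
    cases n with
    | zero => exact absurd hn h
    | succ n =>
      rw [jumpTime_succ]
      gcongr
      exact iInf_le_of_le n (iInf_le _ hn)

variable [MeasurableSpace S] [Countable S] [MeasurableSingletonClass S] (R : S → Measure S)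

theorem pathLaw_eq (z : S) : pathLaw R z = chainLaw (stepKernel R) (z, 0) := rfl

instance (z z' : S) : IsProbabilityMeasure (hittingLaw R z z') := by
  have : IsProbabilityMeasure (pathLaw R z) := by
    rw [pathLaw_eq]
    infer_instance
  exact Measure.isProbabilityMeasure_map (measurable_hittingTime z').aemeasurable

theorem integral_expNeg_hittingTime_of_eq {z' : S} {p : S × ℝ≥0∞} (hp : p.1 = z') (s : ℂ) :
    ∫ ω, expNeg s (hittingTime z' ω) ∂chainLaw (stepKernel R) p = 1 := by
  have h : ∀ᵐ ω ∂chainLaw (stepKernel R) p, expNeg s (hittingTime z' ω) = 1 := by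
    filter_upwards [ae_chainLaw_zero (stepKernel R) (p := fun q : S × ℝ≥0∞ => q.1 = z')
      (measurable_fst (measurableSet_singleton z')) hp] with ω hω
    rw [hittingTime_of_eq hω, expNeg_zero]
  rw [integral_congr_ae h]
  simp

theorem integral_expNeg_hittingTime_of_ne {z' : S} {p : S × ℝ≥0∞} (hp : p.1 ≠ z') {s : ℂ}
    (hs : 0 ≤ s.re) :
    ∫ ω, expNeg s (hittingTime z' ω) ∂chainLaw (stepKernel R) p
      = ∫ q, expNeg s q.2 * ∫ ω, expNeg s (hittingTime z' ω) ∂chainLaw (stepKernel R) q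
          ∂stepLaw R p.1 := by
  have hm := measurable_hittingTime (S := S) z'
  have h : ∀ᵐ ω ∂chainLaw (stepKernel R) p, expNeg s (hittingTime z' ω)
      = expNeg s (shift ω 0).2 * expNeg s (hittingTime z' (shift ω)) := by
    filter_upwards [ae_chainLaw_zero (stepKernel R) (p := fun q : S × ℝ≥0∞ => q.1 ≠ z')
      (measurable_fst (measurableSet_singleton z').compl) hp] with ω hω
    rw [hittingTime_of_ne hω, expNeg_add]
  have hmeas : Measurable fun η : ℕ → S × ℝ≥0∞ => expNeg s (η 0).2 * expNeg s (hittingTime z' η) :=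
    by fun_prop
  have hint : Integrable (fun η : ℕ → S × ℝ≥0∞ => expNeg s (η 0).2 * expNeg s (hittingTime z' η))
      ((chainLaw (stepKernel R) ∘ₖ stepKernel R) p) := by
    refine Integrable.of_bound hmeas.aestronglyMeasurable 1 (ae_of_all _ fun η => ?_)
    rw [norm_mul]
    exact mul_le_one₀ (norm_expNeg_le hs _) (norm_nonneg _) (norm_expNeg_le hs _)
  rw [integral_congr_ae h,
    ← integral_map (φ := shift) (f := fun η : ℕ → S × ℝ≥0∞ =>
      expNeg s (η 0).2 * expNeg s (hittingTime z' η)) (by fun_prop) hmeas.aestronglyMeasurable,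
    ← Kernel.map_apply _ measurable_shift, chainLaw_map_shift, Kernel.integral_comp hint]
  refine integral_congr_ae (ae_of_all _ fun q => ?_)
  -- The chain restarted from `q` has `η 0 = q` almost surely, so the holding-time factor is
  -- constant in the inner integral.
  have hq : ∀ᵐ η ∂chainLaw (stepKernel R) q, expNeg s (η 0).2 * expNeg s (hittingTime z' η)
      = expNeg s q.2 * expNeg s (hittingTime z' η) := by
    filter_upwards [ae_chainLaw_zero (stepKernel R) (p := fun q' : S × ℝ≥0∞ => q'.2 = q.2)
      (measurable_snd (measurableSet_singleton q.2)) rfl] with η hη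
    rw [hη]
  exact (integral_congr_ae hq).trans (integral_const_mul _ _)

/-- The time entering with the initial state of a path does not matter. -/
theorem integral_expNeg_hittingTime (z' : S) (p : S × ℝ≥0∞) {s : ℂ} (hs : 0 ≤ s.re) :
    ∫ ω, expNeg s (hittingTime z' ω) ∂chainLaw (stepKernel R) p
      = JSQ.lst (hittingLaw R p.1 z') s := by
  rw [hittingLaw, lst_map _ (measurable_hittingTime z'), pathLaw_eq]
  by_cases hp : p.1 = z'
  · rw [integral_expNeg_hittingTime_of_eq R hp,
      integral_expNeg_hittingTime_of_eq R (p := (p.1, 0)) hp]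
  -- The first-step formula involves the starting pair only through its state, so both sides become
  -- the same integral.
  · rw [integral_expNeg_hittingTime_of_ne R hp hs,
      integral_expNeg_hittingTime_of_ne R (p := (p.1, 0)) hp hs]

theorem lst_hittingLaw_self (z : S) (s : ℂ) : JSQ.lst (hittingLaw R z z) s = 1 := by
  rw [hittingLaw, lst_map _ (measurable_hittingTime z), pathLaw_eq,
    integral_expNeg_hittingTime_of_eq R rfl]

/-- First-step analysis of the Laplace–Stieltjes transform of a hitting time. -/
theorem exitRate_add_mul_lst_hittingLaw {z z' : S} (hz : z ≠ z') (hR : 0 < exitRate R z) {s : ℂ}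
    (hs : 0 ≤ s.re) :
    (exitRate R z + s) * JSQ.lst (hittingLaw R z z') s
      = ∫ w, JSQ.lst (hittingLaw R w z') s ∂(R z) := by
  have hne : (exitRate R z : ℂ) + s ≠ 0 := by
    intro h
    have := congrArg Complex.re h
    simp at this
    linarith
  have hne' : (exitRate R z : ℂ) ≠ 0 := by exact_mod_cast hR.ne'
  have h1 : JSQ.lst (hittingLaw R z z') s
      = ∫ q, expNeg s q.2 * JSQ.lst (hittingLaw R q.1 z') s ∂stepLaw R z := by
    rw [← integral_expNeg_hittingTime R z' (z, 0) hs,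
      integral_expNeg_hittingTime_of_ne R (p := (z, 0)) hz hs]
    simp_rw [integral_expNeg_hittingTime R z' _ hs]
  have h2 : (((R z Set.univ)⁻¹).toReal : ℂ) = (exitRate R z : ℂ)⁻¹ := by
    rw [ENNReal.toReal_inv, Complex.ofReal_inv]
    rfl
  have hU := ENNReal.toReal_pos_iff.mp hR
  have h3 : IsProbabilityMeasure ((R z Set.univ)⁻¹ • R z) :=
    ⟨by simpa using ENNReal.inv_mul_cancel hU.1.ne' hU.2.ne⟩
  have h4 := isProbabilityMeasure_expMeasure hR
  have h5 : IsProbabilityMeasure ((expMeasure (exitRate R z)).map ENNReal.ofReal) :=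
    Measure.isProbabilityMeasure_map ENNReal.measurable_ofReal.aemeasurable
  rw [h1, stepLaw, if_pos hR]
  simp_rw [mul_comm (expNeg s _)]
  -- With r the exit rate, the product form of `stepLaw` splits off the exponential transform r / (r
  -- + s); its numerator cancels the normalization of the jump law.
  rw [integral_prod_mul (fun w => JSQ.lst (hittingLaw R w z') s) (expNeg s),
    integral_smul_measure, integral_expNeg_expMeasure hR hs, Complex.real_smul, h2]
  field_simp

end CTMC

/-- The five targets need not be distinct, nor different from `z`: the integral is additive in the
measure. This admits the degenerate zero-rate jumps at an empty queue. -/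
theorem CTMC.sum_add_mul_lst_hittingLaw {S : Type*} [MeasurableSpace S] [Countable S]
    [MeasurableSingletonClass S] {R : S → Measure S} {z z' : S} (hz : z ≠ z')
    {a b c d e : ℝ} {za zb zc zd ze : S}
    (ha : 0 ≤ a) (hb : 0 ≤ b) (hc : 0 ≤ c) (hd : 0 ≤ d) (he : 0 < e)
    (hR : R z = ENNReal.ofReal a • Measure.dirac za + ENNReal.ofReal b • Measure.dirac zb
      + ENNReal.ofReal c • Measure.dirac zc + ENNReal.ofReal d • Measure.dirac zd
      + ENNReal.ofReal e • Measure.dirac ze) {s : ℂ} (hs : 0 ≤ s.re) :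
    (a + b + c + d + e + s) * JSQ.lst (hittingLaw R z z') s
      = a * JSQ.lst (hittingLaw R za z') s + b * JSQ.lst (hittingLaw R zb z') s
        + c * JSQ.lst (hittingLaw R zc z') s + d * JSQ.lst (hittingLaw R zd z') s
        + e * JSQ.lst (hittingLaw R ze z') s := by
  have hexit : exitRate R z = a + b + c + d + e := by
    rw [exitRate, hR]
    simp only [Measure.coe_add, Pi.add_apply, Measure.smul_apply, measure_univ, smul_eq_mul,
      mul_one]
    rw [← ENNReal.ofReal_add ha hb, ← ENNReal.ofReal_add (by positivity) hc,
      ← ENNReal.ofReal_add (by positivity) hd, ← ENNReal.ofReal_add (by positivity) he.le,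
      ENNReal.toReal_ofReal (by positivity)]
  have hI (r : ℝ) (w : S) : Integrable (fun w => JSQ.lst (hittingLaw R w z') s)
      (ENNReal.ofReal r • Measure.dirac w) :=
    (integrable_dirac (by simp)).smul_measure ENNReal.ofReal_ne_top
  have h := exitRate_add_mul_lst_hittingLaw R hz (by rw [hexit]; positivity) hs
  rw [hexit, hR,
    integral_add_measure ((((hI _ _).add_measure (hI _ _)).add_measure (hI _ _)).add_measure
      (hI _ _)) (hI _ _),
    integral_add_measure (((hI _ _).add_measure (hI _ _)).add_measure (hI _ _)) (hI _ _),
    integral_add_measure ((hI _ _).add_measure (hI _ _)) (hI _ _),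
    integral_add_measure (hI _ _) (hI _ _)] at h
  simp only [integral_smul_measure, integral_dirac, ENNReal.toReal_ofReal ha,
    ENNReal.toReal_ofReal hb, ENNReal.toReal_ofReal hc, ENNReal.toReal_ofReal hd,
    ENNReal.toReal_ofReal he.le, Complex.real_smul] at h
  push_cast at h
  exact h

/-! ### First-step equations for the tagged customer -/

namespace JSQ

/-- The first-step equations of the transforms of the remaining service time of a tagged customer,
`c i j` belonging to `i` other customers in the queue of the tagged customer and `j` customers in
the other queue. The service rates of the two queues are `m` and `m'`, and `p` and `p'` are the
probabilities of joining them when their lengths are equal. -/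
def FirstStepEquations (lam m m' p p' : ℝ) (s : ℂ) (c : ℕ → ℕ → ℂ) : Prop :=
  ∀ i j : ℕ, (s + lam + m + (if j = 0 then 0 else (m' : ℂ))) * ((i + 1) * c i j)
    = lam * (if i + 1 < j then (i + 1) * c (i + 1) j else 0)
      + lam * p * (if i + 1 = j then (i + 1) * c (i + 1) j else 0)
      + lam * (if j ≤ i then (i + 1) * c i (j + 1) else 0)
      + lam * p' * (if i + 1 = j then (i + 1) * c i (j + 1) else 0)
      + m * (i * c (i - 1) j)
      + m' * (if j = 0 then 0 else (i + 1) * c i (j - 1))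
      + m

theorem first_step_clear_denominators {L m d s I P P' u u₁ u₂ u₃ u₄ : ℂ} (hI : I + 1 ≠ 0)
    (hP : P + P' = 1)
    (h : (L * P + L * P' + I * (m / (I + 1)) + d + m / (I + 1) + s) * u
      = L * P * u₁ + L * P' * u₂ + I * (m / (I + 1)) * u₃ + d * u₄ + m / (I + 1)) :
    (s + L + m + d) * ((I + 1) * u)
      = L * P * ((I + 1) * u₁) + L * P' * ((I + 1) * u₂) + m * (I * u₃) + d * ((I + 1) * u₄)
        + m := by
  have hm : (I + 1) * (m / (I + 1)) = m := mul_div_cancel₀ m hI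
  linear_combination (I + 1) * h - (I + 1) * L * u * hP
    + (-I * u - u + I * u₃ + 1) * hm

/-- The routing probabilities are kept abstract so that one argument serves both positions of the
tagged customer. -/
theorem firstStepEquations_of_clear_denominators {lam m m' p p' : ℝ} {s : ℂ} {c : ℕ → ℕ → ℂ}
    (P P' : ℕ → ℕ → ℝ) (hP : ∀ n k, P n k = if n < k then 1 else if n = k then p else 0)
    (hP' : ∀ n k, P' n k = if k < n then 1 else if n = k then p' else 0) (hp : p + p' = 1)
    (h : ∀ i j : ℕ, (lam * P (i + 1) j + lam * P' (i + 1) j + i * (m / (i + 1)) + j * (m' / j)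
        + m / (i + 1) + s) * c i j
      = lam * P (i + 1) j * c (i + 1) j + lam * P' (i + 1) j * c i (j + 1)
        + i * (m / (i + 1)) * c (i - 1) j + j * (m' / j) * c i (j - 1) + m / (i + 1)) :
    FirstStepEquations lam m m' p p' s c := by
  intro i j
  have hi : (i : ℂ) + 1 ≠ 0 := by exact_mod_cast i.succ_ne_zero
  have hPP : (P (i + 1) j : ℂ) + P' (i + 1) j = 1 := by
    norm_cast
    rw [hP, hP']
    split_ifs <;> first | omega | exact hp | simp
  have h1 := first_step_clear_denominators hi hPP (h i j)
  have hj : (j : ℂ) * ((m' : ℂ) / j) = if j = 0 then 0 else (m' : ℂ) := by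
    split_ifs with hj
    · simp [hj]
    · have : (j : ℂ) ≠ 0 := by exact_mod_cast hj
      field_simp
  rw [hj] at h1
  rw [h1, hP, hP']
  congr 2
  · congr 1
    -- The queue lengths are i + 1 and j because the tagged customer counts; thus joining the other
    -- queue for certain means j < i + 1, that is, j ≤ i.
    rcases lt_trichotomy (i + 1) j with hij | hij | hij
    · simp [hij, hij.ne, show ¬ j < i + 1 by omega, show ¬ j ≤ i by omega]
    · simp [hij, show ¬ j ≤ i by omega]
    · simp [hij, hij.ne', show ¬ i + 1 < j by omega, show j ≤ i by omega]
  · split_ifs <;> simp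

variable (Q : Params)

theorem firstStepEquations_Ustar (hlam : 0 < Q.lam) (hmu1 : 0 < Q.mu1) (hmu2 : 0 < Q.mu2)
    (ha0 : 0 ≤ Q.a1) (ha1 : Q.a1 ≤ 1) {s : ℂ} (hs : 0 ≤ s.re) :
    FirstStepEquations Q.lam Q.mu1 Q.mu2 Q.a1 Q.a2 s (Ustar Q s) := by
  refine firstStepEquations_of_clear_denominators (toQueue1 Q) (toQueue2 Q) (fun _ _ => rfl)
    (fun _ _ => rfl) (add_sub_cancel _ _) fun i j => ?_
  have h1 : 0 ≤ toQueue1 Q (i + 1) j := by unfold toQueue1; split_ifs <;> simp [ha0]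
  have h2 : 0 ≤ toQueue2 Q (i + 1) j := by unfold toQueue2 Params.a2; split_ifs <;> simp [ha1]
  have h := CTMC.sum_add_mul_lst_hittingLaw (R := rates Q) (z := .inQueue1 i j) (z' := .departed)
    (by simp) (mul_nonneg hlam.le h1) (mul_nonneg hlam.le h2) (by positivity) (by positivity)
    (by positivity) rfl hs
  rw [CTMC.lst_hittingLaw_self] at h
  change _ * Ustar Q s i j = _ * Ustar Q s (i + 1) j + _ * Ustar Q s i (j + 1)
    + _ * Ustar Q s (i - 1) j + _ * Ustar Q s i (j - 1) + _ at h
  push_cast at h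
  linear_combination h

/-- Transposing the indices lists the tagged customer's queue first, which swaps the service rates
and the tie-breaking probabilities. -/
theorem firstStepEquations_Vstar (hlam : 0 < Q.lam) (hmu1 : 0 < Q.mu1) (hmu2 : 0 < Q.mu2)
    (ha0 : 0 ≤ Q.a1) (ha1 : Q.a1 ≤ 1) {s : ℂ} (hs : 0 ≤ s.re) :
    FirstStepEquations Q.lam Q.mu2 Q.mu1 Q.a2 Q.a1 s (fun i j => Vstar Q s j i) := by
  refine firstStepEquations_of_clear_denominators (fun n k => toQueue2 Q k n)
    (fun n k => toQueue1 Q k n) (fun n k => ?_) (fun n k => ?_) (sub_add_cancel _ _) fun i j => ?_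
  · simp only [toQueue2, eq_comm]
  · simp only [toQueue1, eq_comm]
  have h1 : 0 ≤ toQueue1 Q j (i + 1) := by unfold toQueue1; split_ifs <;> simp [ha0]
  have h2 : 0 ≤ toQueue2 Q j (i + 1) := by unfold toQueue2 Params.a2; split_ifs <;> simp [ha1]
  have h := CTMC.sum_add_mul_lst_hittingLaw (R := rates Q) (z := .inQueue2 j i) (z' := .departed)
    (by simp) (mul_nonneg hlam.le h1) (mul_nonneg hlam.le h2) (by positivity) (by positivity)
    (by positivity) rfl hs
  rw [CTMC.lst_hittingLaw_self] at h
  change _ * Vstar Q s j i = _ * Vstar Q s (j + 1) i + _ * Vstar Q s j (i + 1)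
    + _ * Vstar Q s (j - 1) i + _ * Vstar Q s j (i - 1) + _ at h
  push_cast at h
  linear_combination h

theorem norm_Ustar_le {s : ℂ} (hs : 0 ≤ s.re) (i j : ℕ) : ‖Ustar Q s i j‖ ≤ 1 := by
  unfold Ustar lawU
  exact norm_lst_le_one _ hs

theorem norm_Vstar_le {s : ℂ} (hs : 0 ≤ s.re) (i j : ℕ) : ‖Vstar Q s i j‖ ≤ 1 := by
  unfold Vstar lawV
  exact norm_lst_le_one _ hs

end JSQ

/-! ### Double power series and the functional equation -/

namespace JSQ

theorem summable_succ_mul_pow {r : ℝ} (h0 : 0 ≤ r) (h1 : r < 1) :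
    Summable fun n : ℕ => (n + 1 : ℝ) * r ^ n := by
  have hr : ‖r‖ < 1 := by rwa [Real.norm_of_nonneg h0]
  simpa [add_mul] using (summable_pow_mul_geometric_of_norm_lt_one 1 hr).add
    (summable_geometric_of_lt_one h0 h1)

theorem summable_mul_pow_pred {r : ℝ} (h0 : 0 ≤ r) (h1 : r < 1) :
    Summable fun n : ℕ => (n : ℝ) * r ^ (n - 1) := by
  rw [← summable_nat_add_iff 1]
  simpa using summable_succ_mul_pow h0 h1

/-- The bound i + 1, rather than 1, also covers the coefficients produced by one differentiation in
x. -/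
theorem summable_norm_coeff_mul_pow {c : ℕ → ℕ → ℂ} (hc : ∀ i j, ‖c i j‖ ≤ i + 1) {x y : ℂ}
    (hx : ‖x‖ < 1) (hy : ‖y‖ < 1) :
    Summable fun p : ℕ × ℕ => ‖c p.1 p.2 * x ^ p.1 * y ^ p.2‖ := by
  have h := (summable_succ_mul_pow (norm_nonneg x) hx).mul_of_nonneg
    (summable_geometric_of_lt_one (norm_nonneg y) hy) (fun n => by positivity)
    (fun n => by positivity)
  refine Summable.of_nonneg_of_le (fun p => norm_nonneg _) (fun p => ?_) h
  rw [norm_mul, norm_mul, norm_pow, norm_pow]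
  gcongr
  exact hc _ _

theorem hasSum_gf {c : ℕ → ℕ → ℂ} (hc : ∀ i j, ‖c i j‖ ≤ i + 1) {x y : ℂ}
    (hx : ‖x‖ < 1) (hy : ‖y‖ < 1) :
    HasSum (fun p : ℕ × ℕ => c p.1 p.2 * x ^ p.1 * y ^ p.2) (gf c x y) :=
  (summable_norm_coeff_mul_pow hc hx hy).of_norm.hasSum

theorem hasSum_pow_mul_pow {x y : ℂ} (hx : ‖x‖ < 1) (hy : ‖y‖ < 1) :
    HasSum (fun p : ℕ × ℕ => x ^ p.1 * y ^ p.2) (1 / ((1 - x) * (1 - y))) := by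
  have h := (hasSum_geometric_of_norm_lt_one hx).mul (hasSum_geometric_of_norm_lt_one hy)
    (summable_mul_of_summable_norm (summable_norm_geometric_of_norm_lt_one hx)
      (summable_norm_geometric_of_norm_lt_one hy))
  rwa [← mul_inv, ← one_div] at h

/-- Multiplying a double power series by `x` shifts its coefficients. -/
theorem gf_shift_left (c : ℕ → ℕ → ℂ) (x y : ℂ) :
    gf (fun i j => if i = 0 then 0 else c (i - 1) j) x y = x * gf c x y := by
  have hinj : Function.Injective fun p : ℕ × ℕ => (p.1 + 1, p.2) := by
    rintro ⟨a, b⟩ ⟨a', b'⟩ h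
    simpa using h
  unfold gf
  rw [← hinj.tsum_eq, ← tsum_mul_left]
  · refine tsum_congr fun p => ?_
    simp only [Nat.add_sub_cancel, Nat.succ_ne_zero, if_false]
    ring
  · rintro ⟨i, j⟩ h
    cases i with
    | zero => simp at h
    | succ i => exact ⟨(i, j), rfl⟩

theorem gf_swap (c : ℕ → ℕ → ℂ) (x y : ℂ) : gf (fun i j => c j i) y x = gf c x y := by
  unfold gf
  rw [← (Equiv.prodComm ℕ ℕ).tsum_eq]
  exact tsum_congr fun p => mul_right_comm _ _ _

theorem gf_shift_right (c : ℕ → ℕ → ℂ) (x y : ℂ) :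
    gf (fun i j => if j = 0 then 0 else c i (j - 1)) x y = y * gf c x y := by
  rw [← gf_swap, ← gf_swap c]
  exact gf_shift_left (fun i j => c j i) y x

theorem gf_zero_right (c : ℕ → ℕ → ℂ) (x y : ℂ) :
    gf (fun i j => if j = 0 then c i j else 0) x y = gf c x 0 := by
  refine tsum_congr fun p => ?_
  by_cases h : p.2 = 0 <;> simp [h]

/-- The derivative of the function `c x ^ i * y ^ j` of two variables. -/
noncomputable def monomialFDeriv (c : ℂ) (i j : ℕ) (q : ℂ × ℂ) : ℂ × ℂ →L[ℂ] ℂ :=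
  (c * (i * q.1 ^ (i - 1)) * q.2 ^ j) • ContinuousLinearMap.fst ℂ ℂ ℂ
    + (c * q.1 ^ i * (j * q.2 ^ (j - 1))) • ContinuousLinearMap.snd ℂ ℂ ℂ

theorem hasFDerivAt_monomial (c : ℂ) (i j : ℕ) (q : ℂ × ℂ) :
    HasFDerivAt (fun q : ℂ × ℂ => c * q.1 ^ i * q.2 ^ j) (monomialFDeriv c i j q) q := by
  have h1 : HasFDerivAt (fun q : ℂ × ℂ => q.1 ^ i) _ q := (hasFDerivAt_fst (𝕜 := ℂ)).pow i
  have h2 : HasFDerivAt (fun q : ℂ × ℂ => q.2 ^ j) _ q := (hasFDerivAt_snd (𝕜 := ℂ)).pow j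
  convert! (h1.const_mul c).mul h2 using 1
  unfold monomialFDeriv
  ext
  · simp
    ring
  · simp

theorem norm_monomialFDeriv_le {c : ℂ} (hc : ‖c‖ ≤ 1) (i j : ℕ) {q : ℂ × ℂ} {r : ℝ}
    (hq : ‖q‖ ≤ r) :
    ‖monomialFDeriv c i j q‖ ≤ i * r ^ (i - 1) * r ^ j + r ^ i * (j * r ^ (j - 1)) := by
  have h1 : ‖q.1‖ ≤ r := (norm_fst_le q).trans hq
  have h2 : ‖q.2‖ ≤ r := (norm_snd_le q).trans hq
  have hr : 0 ≤ r := (norm_nonneg q).trans hq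
  refine (norm_add_le _ _).trans (add_le_add ?_ ?_)
  · rw [norm_smul]
    refine (mul_le_of_le_one_right (norm_nonneg _)
      (ContinuousLinearMap.norm_fst_le ℂ ℂ ℂ)).trans ?_
    rw [norm_mul, norm_mul, norm_mul, norm_pow, norm_pow, Complex.norm_natCast]
    refine mul_le_mul ?_ (by gcongr) (by positivity) (by positivity)
    exact (mul_le_of_le_one_left (by positivity) hc).trans (by gcongr)
  · rw [norm_smul]
    refine (mul_le_of_le_one_right (norm_nonneg _)
      (ContinuousLinearMap.norm_snd_le ℂ ℂ ℂ)).trans ?_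
    rw [norm_mul, norm_mul, norm_mul, norm_pow, norm_pow, Complex.norm_natCast]
    refine mul_le_mul ?_ (by gcongr) (by positivity) (by positivity)
    exact (mul_le_of_le_one_left (by positivity) hc).trans (by gcongr)

theorem summable_monomialFDeriv_bound {r : ℝ} (h0 : 0 ≤ r) (h1 : r < 1) :
    Summable fun p : ℕ × ℕ =>
      p.1 * r ^ (p.1 - 1) * r ^ p.2 + r ^ p.1 * (p.2 * r ^ (p.2 - 1)) :=
  ((summable_mul_pow_pred h0 h1).mul_of_nonneg (summable_geometric_of_lt_one h0 h1)
    (fun n => by positivity) (fun n => by positivity)).add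
  ((summable_geometric_of_lt_one h0 h1).mul_of_nonneg (summable_mul_pow_pred h0 h1)
    (fun n => by positivity) (fun n => by positivity))

theorem norm_prod_lt_one {x y : ℂ} (hx : ‖x‖ < 1) (hy : ‖y‖ < 1) : ‖(x, y)‖ < 1 :=
  max_lt hx hy

theorem summable_monomialFDeriv {c : ℕ → ℕ → ℂ} (hc : ∀ i j, ‖c i j‖ ≤ 1) {q : ℂ × ℂ}
    (hq : ‖q‖ < 1) : Summable fun p : ℕ × ℕ => monomialFDeriv (c p.1 p.2) p.1 p.2 q :=
  (summable_monomialFDeriv_bound (norm_nonneg q) hq).of_norm_bounded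
    fun _ => norm_monomialFDeriv_le (hc _ _) _ _ le_rfl

/-- Termwise differentiation. In the sup norm of `ℂ × ℂ` a ball is a bidisk, and on the one of
radius r, with ‖q‖ < r < 1, the derivatives of the monomials have a summable uniform bound. -/
theorem hasFDerivAt_gf {c : ℕ → ℕ → ℂ} (hc : ∀ i j, ‖c i j‖ ≤ 1) {q : ℂ × ℂ} (hq : ‖q‖ < 1) :
    HasFDerivAt (fun q : ℂ × ℂ => gf c q.1 q.2)
      (∑' p : ℕ × ℕ, monomialFDeriv (c p.1 p.2) p.1 p.2 q) q := by
  obtain ⟨r, hqr, hr⟩ := exists_between hq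
  have h0 : 0 ≤ r := (norm_nonneg q).trans hqr.le
  have hq' : q ∈ Metric.ball (0 : ℂ × ℂ) r := by simpa using hqr
  refine hasFDerivAt_tsum_of_isPreconnected (summable_monomialFDeriv_bound h0 hr)
    Metric.isOpen_ball (convex_ball (0 : ℂ × ℂ) r).isPreconnected
    (fun p q _ => hasFDerivAt_monomial (c p.1 p.2) p.1 p.2 q) (fun p z hz => ?_) hq' ?_ hq'
  · exact norm_monomialFDeriv_le (hc _ _) _ _ (by simpa using (mem_ball_zero_iff.mp hz).le)
  · exact (summable_norm_coeff_mul_pow (fun i j => (hc i j).trans (by simp))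
      ((norm_fst_le q).trans_lt hq) ((norm_snd_le q).trans_lt hq)).of_norm

theorem holomorphicSeries_of_norm_le_one {c : ℕ → ℕ → ℂ} (hc : ∀ i j, ‖c i j‖ ≤ 1) :
    HolomorphicSeries c :=
  ⟨fun _ _ hx hy => summable_norm_coeff_mul_pow (fun i j => (hc i j).trans (by simp)) hx hy,
    fun _ hq => (hasFDerivAt_gf hc
      (norm_prod_lt_one hq.1 hq.2)).differentiableAt.differentiableWithinAt⟩

theorem deriv_gf {c : ℕ → ℕ → ℂ} (hc : ∀ i j, ‖c i j‖ ≤ 1) {x y : ℂ} (hx : ‖x‖ < 1)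
    (hy : ‖y‖ < 1) :
    deriv (fun z => gf c z y) x = gf (fun i j => (i + 1) * c (i + 1) j) x y := by
  have hq := norm_prod_lt_one hx hy
  have h := (hasFDerivAt_gf hc hq).comp_hasDerivAt x
    ((hasDerivAt_id x).prodMk (hasDerivAt_const x y))
  have hinj : Function.Injective fun p : ℕ × ℕ => (p.1 + 1, p.2) := by
    rintro ⟨a, b⟩ ⟨a', b'⟩ h
    simpa using h
  refine h.deriv.trans ?_
  -- The partial derivative in x is the joint derivative evaluated at (1, 0); evaluation is
  -- continuous and linear, so it passes through the sum. The terms with i = 0 vanish, which permits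
  -- reindexing by i + 1.
  rw [← ContinuousLinearMap.apply_apply ((1 : ℂ), (0 : ℂ)),
    ContinuousLinearMap.map_tsum _ (summable_monomialFDeriv hc hq), ← hinj.tsum_eq]
  · refine tsum_congr fun p => ?_
    simp only [monomialFDeriv, ContinuousLinearMap.apply_apply, add_apply,
      smul_apply, ContinuousLinearMap.coe_fst', ContinuousLinearMap.coe_snd',
      smul_eq_mul, Nat.add_sub_cancel]
    push_cast
    ring
  · rintro ⟨i, j⟩ h
    cases i with
    | zero => simp [monomialFDeriv] at h
    | succ i => exact ⟨(i, j), rfl⟩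

theorem norm_succ_mul_le {z : ℂ} (hz : ‖z‖ ≤ 1) (i : ℕ) : ‖((i : ℂ) + 1) * z‖ ≤ i + 1 := by
  rw [norm_mul]
  refine (mul_le_of_le_one_right (norm_nonneg _) hz).trans ?_
  have : ((i : ℂ) + 1) = ((i + 1 : ℕ) : ℂ) := by push_cast; rfl
  rw [this, Complex.norm_natCast]
  push_cast
  rfl

theorem gf_add_mul_deriv {c : ℕ → ℕ → ℂ} (hc : ∀ i j, ‖c i j‖ ≤ 1) {x y : ℂ} (hx : ‖x‖ < 1)
    (hy : ‖y‖ < 1) :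
    gf c x y + x * deriv (fun z => gf c z y) x = gf (fun i j => (i + 1) * c i j) x y := by
  have h1 := hasSum_gf (c := c) (fun i j => (hc i j).trans (by simp)) hx hy
  have h2 := hasSum_gf (c := fun i j => (i + 1) * c i j) (fun i j => norm_succ_mul_le (hc i j) i)
    hx hy
  rw [deriv_gf hc hx hy, ← gf_shift_left, ← eq_sub_iff_add_eq', ← (h2.sub h1).tsum_eq]
  refine tsum_congr fun p => ?_
  dsimp only
  split_ifs with h
  · simp [h]
  · obtain ⟨i, hi⟩ := Nat.exists_eq_succ_of_ne_zero h
    rw [hi]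
    push_cast [Nat.succ_sub_one]
    ring

theorem norm_part_le_one {c : ℕ → ℕ → ℂ} (hc : ∀ i j, ‖c i j‖ ≤ 1) (r : ℕ → ℕ → Prop) (i j : ℕ) :
    ‖part r c i j‖ ≤ 1 := by
  unfold part
  split_ifs
  · exact hc i j
  · simp

/-- The functional equation of the generating function of the solution of the first-step
equations. -/
theorem functional_equation {lam m m' p p' : ℝ} {s : ℂ} {c : ℕ → ℕ → ℂ}
    (hc : ∀ i j, ‖c i j‖ ≤ 1) (h : FirstStepEquations lam m m' p p' s c) {x y : ℂ}
    (hx : ‖x‖ < 1) (hy : ‖y‖ < 1) :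
    (s + lam + (1 - x) * m + (1 - y) * m') * (gf c x y + x * deriv (fun z => gf c z y) x)
        - m' * (gf c x 0 + x * deriv (fun z => gf c z 0) x)
        - lam * deriv (fun z => gf (part (· < ·) c) z y) x
        - lam * (gf (part (· ≥ ·) (beta c)) x y
            + x * deriv (fun z => gf (part (· ≥ ·) (beta c)) z y) x)
        - lam * p * deriv (fun z => gf (part (· = ·) c) z y) x
        - lam * p' * y * (gf (part (· = ·) (delta c)) x y
            + x * deriv (fun z => gf (part (· = ·) (delta c)) z y) x)
      = m / ((1 - x) * (1 - y)) := by
  have hβ := norm_part_le_one (c := beta c) (fun i j => hc i (j + 1)) (· ≥ ·)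
  have hδ := norm_part_le_one (c := delta c) (fun i j => hc i (j + 2)) (· = ·)
  have hlt := norm_part_le_one hc (· < ·)
  have heq := norm_part_le_one hc (· = ·)
  -- All derivatives become coefficient operations; the series at y = 0 is rewritten as one in (x,
  -- y) supported on j = 0.
  rw [gf_add_mul_deriv hc hx hy, gf_add_mul_deriv hc hx (by simp), gf_add_mul_deriv hβ hx hy,
    gf_add_mul_deriv hδ hx hy, deriv_gf hlt hx hy, deriv_gf heq hx hy, ← gf_zero_right _ x y]
  have hE (i j : ℕ) : ‖((i : ℂ) + 1) * c i j‖ ≤ i + 1 := norm_succ_mul_le (hc i j) i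
  have hδE (i j : ℕ) : ‖((i : ℂ) + 1) * part (· = ·) (delta c) i j‖ ≤ i + 1 :=
    norm_succ_mul_le (hδ i j) i
  have s1 := hasSum_gf hE hx hy
  have s2 := hasSum_gf (c := fun i j => if j = 0 then ((i : ℂ) + 1) * c i j else 0)
    (fun i j => by
      split_ifs
      · exact hE i j
      · simp; positivity) hx hy
  have s3 := hasSum_gf (c := fun i j => ((i : ℂ) + 1) * part (· < ·) c (i + 1) j)
    (fun i j => norm_succ_mul_le (hlt _ j) i) hx hy
  have s4 := hasSum_gf (c := fun i j => ((i : ℂ) + 1) * part (· ≥ ·) (beta c) i j)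
    (fun i j => norm_succ_mul_le (hβ i j) i) hx hy
  have s5 := hasSum_gf (c := fun i j => ((i : ℂ) + 1) * part (· = ·) c (i + 1) j)
    (fun i j => norm_succ_mul_le (heq _ j) i) hx hy
  -- The factor y moves the diagonal i = j to i + 1 = j, the tie seen by an arrival, and turns c i
  -- (j + 2) into c i (j + 1).
  have s6 := hasSum_gf
    (c := fun i j => if j = 0 then 0 else ((i : ℂ) + 1) * part (· = ·) (delta c) i (j - 1))
    (fun i j => by
      split_ifs
      · simp; positivity
      · exact hδE i (j - 1)) hx hy
  -- The weight (i - 1) + 1 = i is that of the other customers in the tagged queue, so this series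
  -- is x times the one in `s1`.
  have s7 := hasSum_gf
    (c := fun i j => if i = 0 then 0 else (((i - 1 : ℕ) : ℂ) + 1) * c (i - 1) j)
    (fun i j => by
      split_ifs
      · simp; positivity
      · refine (hE (i - 1) j).trans ?_
        gcongr
        omega) hx hy
  have s8 := hasSum_gf
    (c := fun i j => if j = 0 then 0 else ((i : ℂ) + 1) * c i (j - 1))
    (fun i j => by
      split_ifs
      · simp; positivity
      · exact hE i (j - 1)) hx hy
  have s9 := (hasSum_pow_mul_pow hx hy).mul_left (m : ℂ)
  have hL := (s1.mul_left (s + lam + m + m')).sub (s2.mul_left (m' : ℂ))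
  have hR := ((((((s3.mul_left (lam : ℂ)).add (s5.mul_left (lam * p : ℂ))).add
    (s4.mul_left (lam : ℂ))).add (s6.mul_left (lam * p' : ℂ))).add (s7.mul_left (m : ℂ))).add
    (s8.mul_left (m' : ℂ))).add s9
  -- The identity is reduced to one between coefficients, which is the first-step equation at (i,
  -- j).
  have key := fun hq => hL.tsum_eq.symm.trans ((tsum_congr hq).trans hR.tsum_eq)
  replace key := key fun ⟨i, j⟩ => by
    have k1 : (if i = 0 then 0 else (((i - 1 : ℕ) : ℂ) + 1) * c (i - 1) j) = i * c (i - 1) j := by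
      cases i <;> simp
    have k2 : (if j = 0 then 0 else ((i : ℂ) + 1) * part (· = ·) (delta c) i (j - 1))
        = if i + 1 = j then ((i : ℂ) + 1) * c i (j + 1) else 0 := by
      cases j <;> simp [part, delta]
    have k3 : (s + lam + m + m') * (((i : ℂ) + 1) * c i j)
        - m' * (if j = 0 then ((i : ℂ) + 1) * c i j else 0)
        = (s + lam + m + (if j = 0 then 0 else (m' : ℂ))) * ((i + 1) * c i j) := by
      split_ifs <;> ring
    have k4 : ((i : ℂ) + 1) * part (· < ·) c (i + 1) j
        = if i + 1 < j then ((i : ℂ) + 1) * c (i + 1) j else 0 := by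
      simp only [part, mul_ite, mul_zero]
    have k5 : ((i : ℂ) + 1) * part (· = ·) c (i + 1) j
        = if i + 1 = j then ((i : ℂ) + 1) * c (i + 1) j else 0 := by
      simp only [part, mul_ite, mul_zero]
    have k6 : ((i : ℂ) + 1) * part (· ≥ ·) (beta c) i j
        = if j ≤ i then ((i : ℂ) + 1) * c i (j + 1) else 0 := by
      simp only [part, beta, ge_iff_le, mul_ite, mul_zero]
    dsimp only
    rw [k1, k2, k4, k5, k6]
    linear_combination (x ^ i * y ^ j) * (k3 + h i j)
  rw [gf_shift_left (fun i j => ((i : ℂ) + 1) * c i j),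
    gf_shift_right (fun i j => ((i : ℂ) + 1) * c i j),
    gf_shift_right (fun i j => ((i : ℂ) + 1) * part (· = ·) (delta c) i j)] at key
  linear_combination key

end JSQ

/-! ### Both equations, the second by exchanging the queues -/

/-- Exchanging the two variables transposes the coefficients of a part. -/
theorem JSQ.gf_part_swap (r : ℕ → ℕ → Prop) (c : ℕ → ℕ → ℂ) (x y : ℂ) :
    JSQ.gf (JSQ.part (fun i j => r j i) fun i j => c j i) y x = JSQ.gf (JSQ.part r c) x y :=
  JSQ.gf_swap (JSQ.part r c) x y

theorem proposition1 (Q : JSQ.Params)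
    (hlam : 0 < Q.lam) (hmu1 : 0 < Q.mu1) (hmu2 : 0 < Q.mu2)
    (ha0 : 0 ≤ Q.a1) (ha1 : Q.a1 ≤ 1) (hstab : Q.lam < Q.mu1 + Q.mu2)
    (s : ℂ) (hs : 0 ≤ s.re) :
    -- the power series converge and are holomorphic in the unit bidisk
    (JSQ.HolomorphicSeries (JSQ.Ustar Q s) ∧
      JSQ.HolomorphicSeries (JSQ.part (· < ·) (JSQ.Ustar Q s)) ∧
      JSQ.HolomorphicSeries (JSQ.part (· = ·) (JSQ.Ustar Q s)) ∧
      JSQ.HolomorphicSeries (JSQ.part (· ≥ ·) (JSQ.beta (JSQ.Ustar Q s))) ∧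
      JSQ.HolomorphicSeries (JSQ.part (· = ·) (JSQ.delta (JSQ.Ustar Q s))) ∧
      JSQ.HolomorphicSeries (JSQ.Vstar Q s) ∧
      JSQ.HolomorphicSeries (JSQ.part (· > ·) (JSQ.Vstar Q s)) ∧
      JSQ.HolomorphicSeries (JSQ.part (· = ·) (JSQ.Vstar Q s)) ∧
      JSQ.HolomorphicSeries (JSQ.part (· ≤ ·) (JSQ.alpha (JSQ.Vstar Q s))) ∧
      JSQ.HolomorphicSeries (JSQ.part (· = ·) (JSQ.gamma (JSQ.Vstar Q s)))) ∧
    -- and the two functional equations hold there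
    ∀ x y : ℂ, ‖x‖ < 1 → ‖y‖ < 1 →
      ((s + Q.lam + (1 - x) * Q.mu1 + (1 - y) * Q.mu2)
            * (JSQ.E Q x y s + x * deriv (fun z => JSQ.E Q z y s) x)
          - Q.mu2 * (JSQ.E Q x 0 s + x * deriv (fun z => JSQ.E Q z 0 s) x)
          - Q.lam * deriv (fun z => JSQ.Elt Q z y s) x
          - Q.lam * (JSQ.betaEge Q x y s + x * deriv (fun z => JSQ.betaEge Q z y s) x)
          - Q.lam * Q.a1 * deriv (fun z => JSQ.Eeq Q z y s) x
          - Q.lam * Q.a2 * y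
            * (JSQ.deltaEeq Q x y s + x * deriv (fun z => JSQ.deltaEeq Q z y s) x)
        = Q.mu1 / ((1 - x) * (1 - y))) ∧
      ((s + Q.lam + (1 - x) * Q.mu1 + (1 - y) * Q.mu2)
            * (JSQ.F Q x y s + y * deriv (fun z => JSQ.F Q x z s) y)
          - Q.mu1 * (JSQ.F Q 0 y s + y * deriv (fun z => JSQ.F Q 0 z s) y)
          - Q.lam * deriv (fun z => JSQ.Fgt Q x z s) y
          - Q.lam * (JSQ.alphaFle Q x y s + y * deriv (fun z => JSQ.alphaFle Q x z s) y)
          - Q.lam * Q.a2 * deriv (fun z => JSQ.Feq Q x z s) y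
          - Q.lam * Q.a1 * x
            * (JSQ.gammaFeq Q x y s + y * deriv (fun z => JSQ.gammaFeq Q x z s) y)
        = Q.mu2 / ((1 - x) * (1 - y))) := by
  have hU := JSQ.norm_Ustar_le Q hs
  have hV := JSQ.norm_Vstar_le Q hs
  have hol {c : ℕ → ℕ → ℂ} (hc : ∀ i j, ‖c i j‖ ≤ 1) (r : ℕ → ℕ → Prop) :
      JSQ.HolomorphicSeries (JSQ.part r c) :=
    JSQ.holomorphicSeries_of_norm_le_one (JSQ.norm_part_le_one hc r)
  refine ⟨⟨JSQ.holomorphicSeries_of_norm_le_one hU, hol hU _, hol hU _,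
    hol (c := JSQ.beta (JSQ.Ustar Q s)) (fun i j => hU i (j + 1)) _,
    hol (c := JSQ.delta (JSQ.Ustar Q s)) (fun i j => hU i (j + 2)) _,
    JSQ.holomorphicSeries_of_norm_le_one hV, hol hV _, hol hV _,
    hol (c := JSQ.alpha (JSQ.Vstar Q s)) (fun i j => hV (i + 1) j) _,
    hol (c := JSQ.gamma (JSQ.Vstar Q s)) (fun i j => hV (i + 2) j) _⟩, fun x y hx hy => ⟨?_, ?_⟩⟩
  · exact JSQ.functional_equation hU
      (JSQ.firstStepEquations_Ustar Q hlam hmu1 hmu2 ha0 ha1 hs) hx hy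
  -- The equation is applied to the transposed array at (y, x). Transposition turns `<` into `>`,
  -- `beta` with `≥` into `alpha` with `≤`, and `delta` into `gamma`; the diagonal is preserved.
  · have h := JSQ.functional_equation (c := fun i j => JSQ.Vstar Q s j i) (fun i j => hV j i)
      (JSQ.firstStepEquations_Vstar Q hlam hmu1 hmu2 ha0 ha1 hs) hy hx
    have hF (x y : ℂ) : JSQ.gf (fun i j => JSQ.Vstar Q s j i) y x = JSQ.F Q x y s :=
      JSQ.gf_swap _ x y
    have hgt (x y : ℂ) : JSQ.gf (JSQ.part (· < ·) fun i j => JSQ.Vstar Q s j i) y x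
        = JSQ.Fgt Q x y s := JSQ.gf_part_swap (· > ·) _ x y
    have hle (x y : ℂ) : JSQ.gf (JSQ.part (· ≥ ·) (JSQ.beta fun i j => JSQ.Vstar Q s j i)) y x
        = JSQ.alphaFle Q x y s := JSQ.gf_part_swap (· ≤ ·) (JSQ.alpha (JSQ.Vstar Q s)) x y
    have heq (c : ℕ → ℕ → ℂ) (x y : ℂ) : JSQ.gf (JSQ.part (· = ·) fun i j => c j i) y x
        = JSQ.gf (JSQ.part (· = ·) c) x y := by
      rw [← JSQ.gf_part_swap]
      simp only [eq_comm]
    have hFeq (x y : ℂ) : JSQ.gf (JSQ.part (· = ·) fun i j => JSQ.Vstar Q s j i) y x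
        = JSQ.Feq Q x y s := heq _ x y
    have hγ (x y : ℂ) : JSQ.gf (JSQ.part (· = ·) (JSQ.delta fun i j => JSQ.Vstar Q s j i)) y x
        = JSQ.gammaFeq Q x y s := heq (JSQ.gamma (JSQ.Vstar Q s)) x y
    simp only [hF, hgt, hle, hFeq, hγ] at h
    rw [mul_comm (1 - x)]
    linear_combination h
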